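/- Let $M$ be a smooth ($C^\infty$) finite-dimensional manifold without boundary and $\pi\colon TM\to M$ its tangent bundle. A (smooth) 1-form on $TM$ is \emph{horizontal} if it annihilates every vector tangent to the fibres of $\pi$. A \emph{second order differential equation} on $M$ is a smooth vector field $D$ on $TM$ with $\pi_*(D_v)=v$ for every $v\in TM$. The \emph{contact system} $\Omega$ of $TM$ is the set of all smooth 1-forms $\sigma$ on $TM$ such that $\langle\sigma,D\rangle=0$ for every second order differential equation $D$ on $M$. A \emph{mechanical system} $(M,T_2,\alpha)$ consists of $M$, a smooth (nondegenerate) pseudo-Riemannian metric $T_2$ on $M$ of any signature, and a smooth horizontal 1-form $\alpha$ on $TM$, the \emph{work form}. Let $\theta$ be the Liouville form on $TM$, $\theta_v=\pi^*(i_vT_2)$ for $v\in TM$; let $\omega_2=d\theta$, let $\dot\theta\colon TM\to\mathbb R$, $\dot\theta(v)=T_2(v,v)$, and let $T=\tfrac12\dot\theta$. The \emph{evolution field} of the system is the second order differential equation $D$ that satisfies Newton's equation $$i_D\omega_2+dT+\alpha=0 .$$ The system is called \emph{relativistic} if its evolution field satisfies $D\dot\theta=0$ on $TM$. Theorem. The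 evolution field of $(M,T_2,\alpha)$ exists and is unique, and the system $(M,T_2,\alpha)$ is relativistic if and only if $\alpha\in\Omega$. In particular the condition does not depend on the metric: for any two pseudo-Riemannian metrics $T_2,T_2'$ on $M$ and the same work form $\alpha$, the system $(M,T_2',\alpha)$ is relativistic if and only if $(M,T_2,\alpha)$ is. -/

import Mathlib

open Bundle Set Manifold
open scoped ContDiff

noncomputable section

namespace Mechanics

/-! ### Smooth vector fields, 1-forms and the exterior derivative of a 1-form -/

section Forms

variable {F : Type*} [NormedAddCommGroup F] [NormedSpace ℝ F]
  {H : Type*} [TopologicalSpace H] (J : ModelWithCorners ℝ F H)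
  (N : Type*) [TopologicalSpace N] [ChartedSpace H N] [IsManifold J ∞ N]

/-- Smooth vector fields on `N`. -/
abbrev SmoothVectorField : Type _ :=
  ContMDiffSection J F ∞ (TangentSpace J : N → Type _)

/-- Smooth 1-forms on `N`: smooth sections of the cotangent bundle. -/
abbrev SmoothOneForm : Type _ :=
  ContMDiffSection J (F →L[ℝ] ℝ) ∞ (fun p : N => TangentSpace J p →L[ℝ] ℝ)

variable {J N}

/-- The expression of a field of covectors `β` in the preferred chart at `p`: its pull-back
by the inverse of the chart, as a differential form of degree one on the model space. -/
def chartForm (β : ∀ q : N, TangentSpace J q →L[ℝ] ℝ) (p : N) : F → F [⋀^Fin 1]→L[ℝ] ℝ :=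
  fun y => ContinuousAlternatingMap.ofSubsingleton ℝ F ℝ (0 : Fin 1)
    ((β ((extChartAt J p).symm y)).comp (mfderiv 𝓘(ℝ, F) J (extChartAt J p).symm y))

/-- The exterior derivative `dβ` of a 1-form `β` on a manifold without boundary, evaluated at `p`
on two tangent vectors: `dβ(X, Y)` is computed in the chart at `p`, with the convention
`dβ(X, Y) = X⟨β, Y⟩ - Y⟨β, X⟩ - ⟨β, [X, Y]⟩`. -/
def extDerivOneForm [J.Boundaryless] (β : ∀ q : N, TangentSpace J q →L[ℝ] ℝ) (p : N)
    (X Y : TangentSpace J p) : ℝ :=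
  extDeriv (chartForm β p) (extChartAt J p p)
    ![mfderiv J 𝓘(ℝ, F) (extChartAt J p) p X, mfderiv J 𝓘(ℝ, F) (extChartAt J p) p Y]

end Forms

/-! ### The tangent bundle: second order equations, horizontal forms, the contact system -/

section TangentBundleGeometry

variable (E : Type*) [NormedAddCommGroup E] [NormedSpace ℝ E]
  (M : Type*) [TopologicalSpace M] [ChartedSpace E M] [IsManifold 𝓘(ℝ, E) ∞ M]

/-- The tangent bundle `TM`. -/
abbrev TM : Type _ := TangentBundle 𝓘(ℝ, E) M

/-- `TM` is a smooth manifold (of class `C^∞`, because `M` is). -/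
instance isManifoldTM : IsManifold 𝓘(ℝ, E).tangent ∞ (TM E M) :=
  Bundle.TotalSpace.isManifold E (TangentSpace 𝓘(ℝ, E) : M → Type _)

/-- Smooth vector fields on `TM`. -/
abbrev FieldOnTM : Type _ := SmoothVectorField 𝓘(ℝ, E).tangent (TM E M)

/-- Smooth 1-forms on `TM`. -/
abbrev FormOnTM : Type _ := SmoothOneForm 𝓘(ℝ, E).tangent (TM E M)

variable {E M}

/-- The differential of the projection `π : TM → M` at `v`. -/
def projDeriv (v : TM E M) :
    TangentSpace 𝓘(ℝ, E).tangent v →L[ℝ] TangentSpace 𝓘(ℝ, E) v.proj :=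
  mfderiv 𝓘(ℝ, E).tangent 𝓘(ℝ, E) (fun w : TM E M => w.proj) v

/-- A 1-form on `TM` is horizontal when it annihilates the vectors tangent to the fibres. -/
def IsHorizontal (α : FormOnTM E M) : Prop :=
  ∀ (v : TM E M) (X : TangentSpace 𝓘(ℝ, E).tangent v), projDeriv v X = 0 → α v X = 0

/-- A second order differential equation on `M`: a field `D` on `TM` such that
`π_* D_v = v` for every `v` in `TM`. -/
def IsSecondOrder (D : FieldOnTM E M) : Prop :=
  ∀ v : TM E M, projDeriv v (D v) = v.snd

variable (E M) in
/-- The contact system `Ω` of `TM`: the 1-forms on `TM` incident with every second order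
differential equation. -/
def contactSystem : Set (FormOnTM E M) :=
  {σ | ∀ D : FieldOnTM E M, IsSecondOrder D → ∀ v : TM E M, σ v (D v) = 0}

end TangentBundleGeometry

/-! ### Metrics, the Liouville form, Newton's equation, relativistic systems -/

section MechanicalSystems

variable (E : Type*) [NormedAddCommGroup E] [NormedSpace ℝ E]
  (M : Type*) [TopologicalSpace M] [ChartedSpace E M] [IsManifold 𝓘(ℝ, E) ∞ M]

/-- A smooth pseudo-Riemannian metric on `M` (symmetric, nondegenerate, of any signature). -/
structure PseudoRiemannianMetric where
  /-- the bilinear form on each tangent space -/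
  val : ∀ x : M, TangentSpace 𝓘(ℝ, E) x →L[ℝ] TangentSpace 𝓘(ℝ, E) x →L[ℝ] ℝ
  symm : ∀ (x : M) (u w : TangentSpace 𝓘(ℝ, E) x), val x u w = val x w u
  nondegenerate : ∀ (x : M) (u : TangentSpace 𝓘(ℝ, E) x), (∀ w, val x u w = 0) → u = 0
  contMDiff : ContMDiff 𝓘(ℝ, E) (𝓘(ℝ, E).prod 𝓘(ℝ, E →L[ℝ] E →L[ℝ] ℝ)) ∞
    (fun x : M => TotalSpace.mk' (E →L[ℝ] E →L[ℝ] ℝ)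
      (E := fun x : M => TangentSpace 𝓘(ℝ, E) x →L[ℝ] TangentSpace 𝓘(ℝ, E) x →L[ℝ] ℝ) x (val x))

/-- A classical mechanical system `(M, T₂, α)`: a pseudo-Riemannian metric on the configuration
space and a horizontal 1-form on `TM`, the work form. -/
structure MechanicalSystem where
  metric : PseudoRiemannianMetric E M
  workForm : FormOnTM E M
  horizontal : IsHorizontal workForm

variable {E M}

/-- The covector `i_v T₂` at the base point of `v`, corresponding to `v` by the metric. -/
def momentum (g : PseudoRiemannianMetric E M) (v : TM E M) :
    TangentSpace 𝓘(ℝ, E) v.proj →L[ℝ] ℝ :=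
  g.val v.proj v.snd

/-- The Liouville form `θ` transported to `TM` by the metric: `θ_v` is the pull-back of
`i_v T₂` by the projection `TM → M`. -/
def liouville (g : PseudoRiemannianMetric E M) (v : TM E M) :
    TangentSpace 𝓘(ℝ, E).tangent v →L[ℝ] ℝ :=
  (momentum g v).comp (projDeriv v)

/-- The function `θ̇` on `TM`: the value of (the covector of `M` underlying) `θ_v` on `v`. -/
def thetaDot (g : PseudoRiemannianMetric E M) (v : TM E M) : ℝ :=
  momentum g v v.snd

/-- The kinetic energy `T = θ̇ / 2`. -/
def kineticEnergy (g : PseudoRiemannianMetric E M) (v : TM E M) : ℝ :=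
  (1 / 2 : ℝ) * thetaDot g v

/-- The differential `df` at `v` of a function `f` on `TM`. -/
def differential (f : TM E M → ℝ) (v : TM E M) : TangentSpace 𝓘(ℝ, E).tangent v →L[ℝ] ℝ :=
  mfderiv 𝓘(ℝ, E).tangent 𝓘(ℝ, ℝ) f v

/-- The symplectic form `ω₂ = dθ` on `TM`. -/
def symplecticForm (g : PseudoRiemannianMetric E M) (v : TM E M)
    (X Y : TangentSpace 𝓘(ℝ, E).tangent v) : ℝ :=
  extDerivOneForm (J := 𝓘(ℝ, E).tangent) (liouville g) v X Y

/-- `D` is the field that governs the evolution of the system `S`: the second order equation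
satisfying Newton's equation `i_D ω₂ + dT + α = 0`. -/
def IsEvolutionField (S : MechanicalSystem E M) (D : FieldOnTM E M) : Prop :=
  IsSecondOrder D ∧
    ∀ (v : TM E M) (X : TangentSpace 𝓘(ℝ, E).tangent v),
      symplecticForm S.metric v (D v) X + differential (kineticEnergy S.metric) v X
        + S.workForm v X = 0

/-- The system is relativistic if the field `D` that governs its evolution satisfies `Dθ̇ = 0`. -/
def IsRelativistic (S : MechanicalSystem E M) : Prop :=
  ∃ D : FieldOnTM E M, IsEvolutionField S D ∧
    ∀ v : TM E M, differential (thetaDot S.metric) v (D v) = 0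

end MechanicalSystems

end Mechanics

end

/-! Pair Newton's equation with the evolution field `D` itself. Since `ω₂(D, D) = 0`, what remains
is `dT(D) + α(D) = 0`, that is `Dθ̇ = -2 α(D)`, so the system is relativistic iff `α(D) = 0`. A
horizontal form sees only `π_* D_v = v`, so `α(D)` is the same function for every second order
equation. Its vanishing for one of them is membership in the contact system, where no metric occurs.
Existence and uniqueness of `D` are pointwise. In coordinates `(x, u)` on `TM`, Newton's equation
for `(u, b)` reduces to a linear equation `G_x b = force`, uniquely solvable because `G_x` is
invertible (`model_newton_iff`, `isNewtonVector_chartFrame_iff`). The solution is smooth in `(x,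
u)`, and uniqueness makes the local solutions agree. Computing `dθ` near a point in one fixed chart
rests on `extDerivOneForm_eq`. -/

noncomputable section

set_option maxSynthPendingDepth 3

namespace Mechanics

/-! ### Vector fields, covectors and the exterior derivative in a fixed chart. -/

section ChartCalculus

variable {F : Type*} [NormedAddCommGroup F] [NormedSpace ℝ F]
  {H : Type*} [TopologicalSpace H] {J : ModelWithCorners ℝ F H} [J.Boundaryless]
  {N : Type*} [TopologicalSpace N] [ChartedSpace H N]

/-- The derivative of the inverse of the preferred chart at `p`. -/
def chartFrame (J : ModelWithCorners ℝ F H) (p : N) (y : F) :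
    F →L[ℝ] TangentSpace J ((extChartAt J p).symm y) :=
  mfderiv 𝓘(ℝ, F) J (extChartAt J p).symm y

/-- The derivative of the preferred chart at `p`. -/
def chartCoframe (J : ModelWithCorners ℝ F H) (p q : N) : TangentSpace J q →L[ℝ] F :=
  mfderiv J 𝓘(ℝ, F) (extChartAt J p) q

/-- The expression of a field of covectors in the preferred chart at `p`. -/
def chartCovector (β : ∀ q : N, TangentSpace J q →L[ℝ] ℝ) (p : N) (y : F) : F →L[ℝ] ℝ :=
  (β ((extChartAt J p).symm y)).comp (chartFrame J p y)

lemma mdifferentiableAt_extChartAt_symm [IsManifold J 1 N] {p : N} {y : F}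
    (hy : y ∈ (extChartAt J p).target) :
    MDifferentiableAt 𝓘(ℝ, F) J (extChartAt J p).symm y := by
  have := mdifferentiableWithinAt_extChartAt_symm (I := J) hy
  rwa [J.range_eq_univ, mdifferentiableWithinAt_univ] at this

lemma chartFrame_chartCoframe [IsManifold J 1 N] {p : N} {y : F}
    (hy : y ∈ (extChartAt J p).target) (X : TangentSpace J ((extChartAt J p).symm y)) :
    chartFrame J p y (chartCoframe J p ((extChartAt J p).symm y) X) = X := by
  have := mfderivWithin_extChartAt_symm_comp_mfderiv_extChartAt (I := J) hy
  rw [J.range_eq_univ, mfderivWithin_univ] at this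
  exact congrArg (fun L => L X) this

lemma chartCoframe_chartFrame [IsManifold J 1 N] {p : N} {y : F}
    (hy : y ∈ (extChartAt J p).target) (X : F) :
    chartCoframe J p ((extChartAt J p).symm y) (chartFrame J p y X) = X := by
  have := mfderiv_extChartAt_comp_mfderivWithin_extChartAt_symm (I := J) hy
  rw [J.range_eq_univ, mfderivWithin_univ] at this
  exact congrArg (fun L => L X) this

lemma chartFrame_surjective [IsManifold J 1 N] {p : N} {y : F}
    (hy : y ∈ (extChartAt J p).target) : Function.Surjective (chartFrame J p y) :=
  fun X => ⟨_, chartFrame_chartCoframe hy X⟩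

lemma chartFrame_injective [IsManifold J 1 N] {p : N} {y : F}
    (hy : y ∈ (extChartAt J p).target) : Function.Injective (chartFrame J p y) :=
  Function.LeftInverse.injective (chartCoframe_chartFrame hy)

/-- The trivialization of the tangent bundle at `p` is the derivative of the chart, so in it this
coordinate field is the constant `a`. -/
lemma contMDiffOn_chartFrame [IsManifold J ∞ N] (p : N) (a : F) :
    ContMDiffOn 𝓘(ℝ, F) J.tangent ∞
      (fun y => TotalSpace.mk' F (E := (TangentSpace J : N → Type _))
        ((extChartAt J p).symm y) (chartFrame J p y a)) (extChartAt J p).target := by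
  have hmem : ∀ y ∈ (extChartAt J p).target, (extChartAt J p).symm y ∈ (chartAt H p).source :=
    fun y hy => by
      rw [← extChartAt_source J]
      exact (extChartAt J p).map_target hy
  refine ((trivializationAt F (TangentSpace J) p).contMDiffOn_iff (n := ∞) (IB := J)
    (fun y hy => ?_)).2 ⟨contMDiffOn_extChartAt_symm p, ?_⟩
  · exact hmem y hy
  · refine (contMDiffOn_const (c := a)).congr fun y hy => ?_
    have h1 := TangentBundle.continuousLinearMapAt_trivializationAt (I := J) (hmem y hy)
    have h2 := congrArg (fun L => L (chartFrame J p y a)) h1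
    refine Eq.trans ?_ (h2.trans (chartCoframe_chartFrame hy a))
    -- `linearMapAt` is zero off the base set, hence the membership proof.
    rw [Bundle.Trivialization.continuousLinearMapAt_apply,
      Bundle.Trivialization.linearMapAt_apply,
      if_pos (show _ ∈ (trivializationAt F (TangentSpace J) p).baseSet from hmem y hy)]

omit [J.Boundaryless] in
lemma contDiffOn_of_contMDiffOn_trivial {f : F → ℝ} {s : Set F} {b : F → N}
    (h : ContMDiffOn 𝓘(ℝ, F) (J.prod 𝓘(ℝ, ℝ)) ∞
      (fun y => TotalSpace.mk' ℝ (E := Bundle.Trivial N ℝ) (b y) (f y)) s) :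
    ContDiffOn ℝ ∞ f s := by
  rw [← contMDiffOn_iff_contDiffOn]
  exact fun y hy => (contMDiffWithinAt_totalSpace.1 (h y hy)).2

lemma contDiffOn_chartCovector [FiniteDimensional ℝ F] [IsManifold J ∞ N]
    (β : SmoothOneForm J N) (p : N) :
    ContDiffOn ℝ ∞ (chartCovector (fun q => β q) p) (extChartAt J p).target := by
  rw [contDiffOn_clm_apply]
  intro a
  exact contDiffOn_of_contMDiffOn_trivial (J := J) (ContMDiffOn.clm_bundle_apply
    (E₂ := Bundle.Trivial N ℝ)
    (β.contMDiff.comp_contMDiffOn (contMDiffOn_extChartAt_symm p)) (contMDiffOn_chartFrame p a))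

-- Smoothness test for a field known only pointwise: its coordinates in the chart at `p` are enough.
omit [J.Boundaryless] in
lemma contMDiffAt_section_of_chartCoframe [IsManifold J ∞ N] {V : ∀ q : N, TangentSpace J q}
    {p : N} {Z : F → F} (hZ : ContDiffAt ℝ ∞ Z (extChartAt J p p))
    (h : ∀ q ∈ (extChartAt J p).source, chartCoframe J p q (V q) = Z (extChartAt J p q)) :
    ContMDiffAt J J.tangent ∞
      (fun q => TotalSpace.mk' F (E := (TangentSpace J : N → Type _)) q (V q)) p := by
  rw [contMDiffAt_section]
  refine (hZ.contMDiffAt.comp p (contMDiffAt_extChartAt (I := J))).congr_of_eventuallyEq ?_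
  filter_upwards [extChartAt_source_mem_nhds (I := J) p] with q hq
  have hq' : q ∈ (chartAt H p).source := by rwa [← extChartAt_source J]
  have h1 := TangentBundle.continuousLinearMapAt_trivializationAt (I := J) hq'
  refine Eq.trans ?_ ((congrArg (fun L => L (V q)) h1).trans (h q hq))
  rw [Bundle.Trivialization.continuousLinearMapAt_apply,
    Bundle.Trivialization.linearMapAt_apply,
    if_pos (show _ ∈ (trivializationAt F (TangentSpace J) p).baseSet from hq')]

omit [J.Boundaryless] in
lemma chartForm_eq (β : ∀ q : N, TangentSpace J q →L[ℝ] ℝ) (p : N) (y : F) :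
    chartForm β p y =
      ContinuousAlternatingMap.ofSubsingleton ℝ F ℝ (0 : Fin 1) (chartCovector β p y) := rfl

omit [J.Boundaryless] in
lemma differentiableAt_chartForm {β : ∀ q : N, TangentSpace J q →L[ℝ] ℝ} {p : N} {y : F}
    (h : DifferentiableAt ℝ (chartCovector β p) y) : DifferentiableAt ℝ (chartForm β p) y :=
  ((ContinuousAlternatingMap.ofSubsingletonLIE (𝕜 := ℝ) (E := F) (F := ℝ)
    (0 : Fin 1)).toContinuousLinearEquiv |>.differentiableAt).comp y h

omit [J.Boundaryless] in
lemma extDeriv_chartForm {β : ∀ q : N, TangentSpace J q →L[ℝ] ℝ} {p : N} {y : F}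
    (h : DifferentiableAt ℝ (chartCovector β p) y) (X Y : F) :
    extDeriv (chartForm β p) y ![X, Y] =
      fderiv ℝ (chartCovector β p) y X Y - fderiv ℝ (chartCovector β p) y Y X := by
  have key : ∀ w : F, (fun z => chartForm β p z ![w]) = fun z => chartCovector β p z w := by
    intro w; ext z; simp [chartForm_eq]
  have key2 : ∀ w u : F, fderiv ℝ (fun z => chartCovector β p z w) y u =
      fderiv ℝ (chartCovector β p) y u w := by
    intro w u
    rw [fderiv_clm_apply h (differentiableAt_const w)]
    simp
  rw [extDeriv_apply (differentiableAt_chartForm h)]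
  -- The `i`-th term differentiates along the `i`-th argument and evaluates on the other one.
  have e0 : (0 : Fin 2).removeNth ![X, Y] = ![Y] := by ext i; fin_cases i; rfl
  have e1 : (1 : Fin 2).removeNth ![X, Y] = ![X] := by ext i; fin_cases i; rfl
  rw [Fin.sum_univ_two, e0, e1, key, key, key2, key2]
  simp [sub_eq_add_neg]

lemma contDiffAt_transition [IsManifold J ∞ N] {p q r : N}
    (hp : r ∈ (extChartAt J p).source) (hq : r ∈ (extChartAt J q).source) :
    ContDiffAt ℝ ∞ (extChartAt J p ∘ (extChartAt J q).symm) (extChartAt J q r) := by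
  have := contDiffWithinAt_ext_coord_change (I := J) (n := ∞) p q (y := extChartAt J q r) (by
    rw [PartialEquiv.trans_source'', PartialEquiv.symm_symm, PartialEquiv.symm_target]
    exact mem_image_of_mem _ ⟨hq, hp⟩)
  rwa [J.range_eq_univ, contDiffWithinAt_univ] at this

lemma chartCovector_apply_chartCoframe [IsManifold J 1 N]
    (β : ∀ q : N, TangentSpace J q →L[ℝ] ℝ) {p q : N} (hq : q ∈ (extChartAt J p).source)
    (X : TangentSpace J q) :
    chartCovector β p (extChartAt J p q) (chartCoframe J p q X) = β q X := by
  obtain ⟨z, hz, rfl⟩ : ∃ z ∈ (extChartAt J p).target, (extChartAt J p).symm z = q :=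
    ⟨_, (extChartAt J p).map_source hq, (extChartAt J p).left_inv hq⟩
  rw [(extChartAt J p).right_inv hz]
  exact congrArg _ (chartFrame_chartCoframe hz X)

lemma chartCoframe_chartFrame_eq_fderiv [IsManifold J 1 N] {p q : N} {y : F}
    (hy : y ∈ (extChartAt J q).target)
    (hp : (extChartAt J q).symm y ∈ (extChartAt J p).source) (a : F) :
    chartCoframe J p ((extChartAt J q).symm y) (chartFrame J q y a) =
      fderiv ℝ (extChartAt J p ∘ (extChartAt J q).symm) y a := by
  have h := mfderiv_comp y (mdifferentiableAt_extChartAt (I := J) (x := p)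
    (by rwa [← extChartAt_source J])) (mdifferentiableAt_extChartAt_symm hy)
  rw [mfderiv_eq_fderiv] at h
  exact (congrArg (fun L => L a) h).symm

lemma chartCoframe_eq_fderiv_transition [IsManifold J 1 N] {p q r : N}
    (hp : r ∈ (extChartAt J p).source) (hq : r ∈ (extChartAt J q).source)
    (X : TangentSpace J r) :
    chartCoframe J p r X = fderiv ℝ (extChartAt J p ∘ (extChartAt J q).symm) (extChartAt J q r)
      (chartCoframe J q r X) := by
  obtain ⟨z, hz, rfl⟩ : ∃ z ∈ (extChartAt J q).target, (extChartAt J q).symm z = r :=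
    ⟨_, (extChartAt J q).map_source hq, (extChartAt J q).left_inv hq⟩
  rw [(extChartAt J q).right_inv hz, ← chartCoframe_chartFrame_eq_fderiv hz hp,
    chartFrame_chartCoframe hz]

lemma chartCovector_transition [IsManifold J 1 N] (β : ∀ q : N, TangentSpace J q →L[ℝ] ℝ)
    {p q : N} {y : F} (hy : y ∈ (extChartAt J q).target)
    (hp : (extChartAt J q).symm y ∈ (extChartAt J p).source) :
    chartCovector β q y = (chartCovector β p ((extChartAt J p ∘ (extChartAt J q).symm) y)).comp
      (fderiv ℝ (extChartAt J p ∘ (extChartAt J q).symm) y) := by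
  ext a
  rw [ContinuousLinearMap.comp_apply, ← chartCoframe_chartFrame_eq_fderiv hy hp]
  exact (chartCovector_apply_chartCoframe β hp _).symm

/-- The definition uses the preferred chart at `q`, which jumps with `q`. Because `d` commutes with
pull-back by the transition map `ψ`, one chart at `p` serves for all nearby `q`. -/
lemma extDerivOneForm_eq [IsManifold J ∞ N] {β : ∀ q : N, TangentSpace J q →L[ℝ] ℝ} {p q : N}
    (hq : q ∈ (extChartAt J p).source)
    (hβ : DifferentiableAt ℝ (chartCovector β p) (extChartAt J p q)) (X Y : TangentSpace J q) :
    extDerivOneForm β q X Y =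
      fderiv ℝ (chartCovector β p) (extChartAt J p q) (chartCoframe J p q X)
          (chartCoframe J p q Y) -
        fderiv ℝ (chartCovector β p) (extChartAt J p q) (chartCoframe J p q Y)
          (chartCoframe J p q X) := by
  set ψ : F → F := extChartAt J p ∘ (extChartAt J q).symm with hψ
  have hqq := mem_extChartAt_source (I := J) q
  have hψq : ψ (extChartAt J q q) = extChartAt J p q := by
    simp [hψ]
  have hev : chartForm β q =ᶠ[nhds (extChartAt J q q)]
      fun y => (chartForm β p (ψ y)).compContinuousLinearMap (fderiv ℝ ψ y) := by
    have h2 : ∀ᶠ y in nhds (extChartAt J q q),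
        (extChartAt J q).symm y ∈ (extChartAt J p).source := by
      refine (continuousAt_extChartAt_symm q).eventually_mem ?_
      rw [extChartAt_to_inv]
      exact (isOpen_extChartAt_source p).mem_nhds hq
    filter_upwards [extChartAt_target_mem_nhds (I := J) q, h2] with y hy hy2
    rw [chartForm_eq, chartForm_eq, chartCovector_transition β hy hy2]
    ext m
    simp [hψ]
  have hβ' : DifferentiableAt ℝ (chartForm β p) (ψ (extChartAt J q q)) := by
    rw [hψq]; exact differentiableAt_chartForm hβ
  have hmat : (fderiv ℝ ψ (extChartAt J q q)) ∘ ![chartCoframe J q q X, chartCoframe J q q Y] =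
      ![chartCoframe J p q X, chartCoframe J p q Y] := by
    rw [chartCoframe_eq_fderiv_transition hq hqq X, chartCoframe_eq_fderiv_transition hq hqq Y]
    ext i; fin_cases i <;> rfl
  change extDeriv (chartForm β q) (extChartAt J q q)
    ![chartCoframe J q q X, chartCoframe J q q Y] = _
  -- Class `C²` of `ψ` gives the symmetry of its second derivative, which cancels the extra terms.
  rw [hev.extDeriv_eq, extDeriv_pullback hβ' ((contDiffAt_transition hq hqq).of_le
    (ENat.LEInfty.out : (2 : WithTop ℕ∞) ≤ ∞)) (by simp),
    ContinuousAlternatingMap.compContinuousLinearMap_apply, hmat, hψq, extDeriv_chartForm hβ]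

omit [J.Boundaryless] in
lemma mfderiv_eq_fderiv_chart [IsManifold J 1 N] {f : N → ℝ} {p q : N}
    (hq : q ∈ (extChartAt J p).source)
    (hf : DifferentiableAt ℝ (f ∘ (extChartAt J p).symm) (extChartAt J p q))
    (X : TangentSpace J q) :
    mfderiv J 𝓘(ℝ, ℝ) f q X =
      fderiv ℝ (f ∘ (extChartAt J p).symm) (extChartAt J p q) (chartCoframe J p q X) := by
  have hq' : q ∈ (chartAt H p).source := by rwa [← extChartAt_source J]
  have hev : f =ᶠ[nhds q] (f ∘ (extChartAt J p).symm) ∘ extChartAt J p := by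
    filter_upwards [extChartAt_source_mem_nhds' (I := J) hq] with r hr
    exact congrArg f ((extChartAt J p).left_inv hr).symm
  rw [hev.mfderiv_eq]
  have h := mfderiv_comp q hf.mdifferentiableAt (mdifferentiableAt_extChartAt (I := J) hq')
  rw [mfderiv_eq_fderiv] at h
  exact congrArg (fun L => L X) h

end ChartCalculus

/-! ### Newton's equation on an open set of `E × E`. -/

section LocalNewton

variable {E : Type*} [NormedAddCommGroup E] [NormedSpace ℝ E]

/-- The Liouville form of a field `G` of bilinear forms on an open set of `E`. -/
def modelLiouville (G : E → E →L[ℝ] E →L[ℝ] ℝ) (z : E × E) : E × E →L[ℝ] ℝ :=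
  (G z.1 z.2).comp (ContinuousLinearMap.fst ℝ E E)

/-- The function `θ̇` of a field `G` of bilinear forms. -/
def modelThetaDot (G : E → E →L[ℝ] E →L[ℝ] ℝ) (z : E × E) : ℝ := G z.1 z.2 z.2

/-- The covector that Newton's equation prescribes for the acceleration, in coordinates. -/
def modelForce (G : E → E →L[ℝ] E →L[ℝ] ℝ) (A : E × E → E × E →L[ℝ] ℝ) (z : E × E) :
    E →L[ℝ] ℝ :=
  (1 / 2 : ℝ) • ((fderiv ℝ G z.1).flip z.2).flip z.2 - fderiv ℝ G z.1 z.2 z.2 -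
    (A z).comp (ContinuousLinearMap.inl ℝ E E)

/-- The second order equation in coordinates. -/
def modelSpray (G : E → E →L[ℝ] E →L[ℝ] ℝ) (A : E × E → E × E →L[ℝ] ℝ) (z : E × E) : E × E :=
  (z.2, (G z.1).inverse (modelForce G A z))

variable {G : E → E →L[ℝ] E →L[ℝ] ℝ} {A : E × E → E × E →L[ℝ] ℝ} {z : E × E}

lemma hasFDerivAt_modelMomentum (hG : DifferentiableAt ℝ G z.1) :
    HasFDerivAt (fun z : E × E => G z.1 z.2)
      (((fderiv ℝ G z.1).flip z.2).comp (ContinuousLinearMap.fst ℝ E E) +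
        (G z.1).comp (ContinuousLinearMap.snd ℝ E E)) z := by
  have h0 : HasFDerivAt (fun z : E × E => G z.1)
      ((fderiv ℝ G z.1).comp (ContinuousLinearMap.fst ℝ E E)) z :=
    hG.hasFDerivAt.comp z hasFDerivAt_fst
  have h := h0.clm_apply (hasFDerivAt_snd (𝕜 := ℝ) (p := z))
  refine h.congr_fderiv ?_
  ext w <;> simp

lemma hasFDerivAt_modelLiouville (hG : DifferentiableAt ℝ G z.1) :
    HasFDerivAt (modelLiouville G)
      (((ContinuousLinearMap.compL ℝ (E × E) E ℝ).flip (ContinuousLinearMap.fst ℝ E E)).comp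
      (((fderiv ℝ G z.1).flip z.2).comp (ContinuousLinearMap.fst ℝ E E) +
        (G z.1).comp (ContinuousLinearMap.snd ℝ E E))) z :=
  ((ContinuousLinearMap.compL ℝ (E × E) E ℝ).flip
    (ContinuousLinearMap.fst ℝ E E)).hasFDerivAt.comp z (hasFDerivAt_modelMomentum hG)

lemma fderiv_modelLiouville_apply (hG : DifferentiableAt ℝ G z.1) (Z W : E × E) :
    fderiv ℝ (modelLiouville G) z Z W = fderiv ℝ G z.1 Z.1 z.2 W.1 + G z.1 Z.2 W.1 := by
  rw [(hasFDerivAt_modelLiouville hG).fderiv]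
  simp

lemma hasFDerivAt_modelThetaDot (hG : DifferentiableAt ℝ G z.1) :
    HasFDerivAt (modelThetaDot G)
      ((G z.1 z.2).comp (ContinuousLinearMap.snd ℝ E E) +
        ((((fderiv ℝ G z.1).flip z.2).comp (ContinuousLinearMap.fst ℝ E E) +
        (G z.1).comp (ContinuousLinearMap.snd ℝ E E))).flip z.2) z :=
  (hasFDerivAt_modelMomentum hG).clm_apply (hasFDerivAt_snd (𝕜 := ℝ) (p := z))

lemma fderiv_modelThetaDot_apply (hG : DifferentiableAt ℝ G z.1)
    (hsymm : ∀ u w, G z.1 u w = G z.1 w u) (W : E × E) :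
    fderiv ℝ (modelThetaDot G) z W = fderiv ℝ G z.1 W.1 z.2 z.2 + 2 * G z.1 z.2 W.2 := by
  rw [(hasFDerivAt_modelThetaDot hG).fderiv]
  simp [hsymm W.2 z.2]
  ring

/-- Newton's equation in coordinates, at a vector `Z` with first component the velocity. -/
lemma model_newton_iff (hG : DifferentiableAt ℝ G z.1)
    (hsymm : ∀ u w, G z.1 u w = G z.1 w u)
    (hA : ∀ b, A z (0, b) = 0) (b : E) :
    (∀ W : E × E, fderiv ℝ (modelLiouville G) z (z.2, b) W -
        fderiv ℝ (modelLiouville G) z W (z.2, b) +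
        (1 / 2 : ℝ) * fderiv ℝ (modelThetaDot G) z W + A z W = 0) ↔
      G z.1 b = modelForce G A z := by
  -- Horizontality: `A z` depends only on the first component.
  have hA' : ∀ W : E × E, A z W = A z (W.1, 0) := fun W => by
    have : W = (W.1, 0) + (0, W.2) := by simp
    conv_lhs => rw [this, map_add, hA, add_zero]
  simp only [fderiv_modelLiouville_apply hG, fderiv_modelThetaDot_apply hG hsymm,
    ContinuousLinearMap.ext_iff]
  have hF : ∀ a, modelForce G A z a = (1 / 2 : ℝ) * fderiv ℝ G z.1 a z.2 z.2 -
      fderiv ℝ G z.1 z.2 z.2 a - A z (a, 0) := fun a => by simp [modelForce]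
  constructor
  -- Test vectors `(a, 0)` already determine `G z.1 b`.
  · intro h a
    have := h (a, 0)
    rw [hF]
    simp only [map_zero, zero_apply] at this
    linarith
  -- The vertical part `c` of `W` contributes `-G(c, u) + G(u, c)`, zero by symmetry; this uses that
  -- the first component of the solution is the velocity.
  · intro h W
    have := h W.1
    rw [hF] at this
    rw [hA' W, this, hsymm W.2 z.2]
    ring

/-- Nondegeneracy is injectivity into the dual, which has the same finite dimension. -/
lemma isInvertible_of_nondegenerate [FiniteDimensional ℝ E] {B : E →L[ℝ] E →L[ℝ] ℝ}
    (hB : ∀ u, (∀ w, B u w = 0) → u = 0) : B.IsInvertible := by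
  have hinj : Function.Injective (B : E →ₗ[ℝ] E →L[ℝ] ℝ) := by
    rw [injective_iff_map_eq_zero]
    intro u hu
    exact hB u fun w => congrArg (fun L : E →L[ℝ] ℝ => L w) hu
  have hfin : Module.finrank ℝ E = Module.finrank ℝ (E →L[ℝ] ℝ) := by
    rw [← (LinearMap.toContinuousLinearMap (𝕜 := ℝ) (E := E) (F' := ℝ)).finrank_eq]
    exact (Subspace.dual_finrank_eq).symm
  refine ⟨(LinearEquiv.ofInjectiveOfFinrankEq (B : E →ₗ[ℝ] E →L[ℝ] ℝ) hinj
    hfin).toContinuousLinearEquiv, ?_⟩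
  ext u w
  rfl

/-- `inverse` is zero at a non-invertible map, so `hinv` is what makes `modelSpray` a genuine
solution. -/
lemma eq_modelSpray_iff (hinv : (G z.1).IsInvertible) (Z : E × E) :
    Z = modelSpray G A z ↔ Z.1 = z.2 ∧ G z.1 Z.2 = modelForce G A z := by
  rw [modelSpray, Prod.ext_iff, eq_comm (a := Z.2), hinv.inverse_apply_eq,
    eq_comm (b := G z.1 Z.2)]

lemma contDiffAt_flip_apply {X V W Y : Type*} [NormedAddCommGroup X] [NormedSpace ℝ X]
    [NormedAddCommGroup V] [NormedSpace ℝ V] [NormedAddCommGroup W] [NormedSpace ℝ W]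
    [NormedAddCommGroup Y] [NormedSpace ℝ Y] {f : X → V →L[ℝ] W →L[ℝ] Y} {g : X → W} {x : X}
    (hf : ContDiffAt ℝ ∞ f x) (hg : ContDiffAt ℝ ∞ g x) :
    ContDiffAt ℝ ∞ (fun x => (f x).flip (g x)) x :=
  ((ContinuousLinearMap.flipₗᵢ ℝ V W Y).contDiff.contDiffAt.comp x hf).clm_apply hg

lemma contDiffAt_modelForce (hG : ContDiffAt ℝ ∞ G z.1) (hA : ContDiffAt ℝ ∞ A z) :
    ContDiffAt ℝ ∞ (modelForce G A) z := by
  have hsnd : ContDiffAt ℝ ∞ (Prod.snd : E × E → E) z := contDiffAt_snd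
  have hdG : ContDiffAt ℝ ∞ (fun z : E × E => fderiv ℝ G z.1) z := 
    (hG.fderiv_right (m := ∞) (by simp)).comp z contDiffAt_fst
  have h1 : ContDiffAt ℝ ∞ (fun z : E × E => (fderiv ℝ G z.1).flip z.2) z :=
    contDiffAt_flip_apply hdG hsnd
  have h2 : ContDiffAt ℝ ∞ (fun z : E × E => ((fderiv ℝ G z.1).flip z.2).flip z.2) z :=
    contDiffAt_flip_apply h1 hsnd
  have h3 : ContDiffAt ℝ ∞ (fun z : E × E => fderiv ℝ G z.1 z.2) z := hdG.clm_apply hsnd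
  have h4 : ContDiffAt ℝ ∞ (fun z : E × E => fderiv ℝ G z.1 z.2 z.2) z := h3.clm_apply hsnd
  exact ((h2.const_smul (1 / 2 : ℝ)).sub h4).sub (hA.clm_comp contDiffAt_const)

lemma contDiffAt_modelSpray [FiniteDimensional ℝ E] (hG : ContDiffAt ℝ ∞ G z.1)
    (hA : ContDiffAt ℝ ∞ A z) (hinv : (G z.1).IsInvertible) :
    ContDiffAt ℝ ∞ (modelSpray G A) z := by
  -- Smoothness of operator inversion requires a complete space.
  have := FiniteDimensional.complete ℝ E
  have hsnd : ContDiffAt ℝ ∞ (Prod.snd : E × E → E) z := contDiffAt_snd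
  have hG1 : ContDiffAt ℝ ∞ (fun z : E × E => G z.1) z := hG.comp z contDiffAt_fst
  have hI : ContDiffAt ℝ ∞ (fun z : E × E => (G z.1).inverse) z := by
    have h := hinv.contDiffAt_map_inverse (n := ∞)
    exact h.comp z hG1
  exact hsnd.prodMk (hI.clm_apply (contDiffAt_modelForce hG hA))

end LocalNewton

/-! ### Charts of `TM` as position and velocity coordinates. -/

section TangentBundleCharts

variable {E : Type*} [NormedAddCommGroup E] [NormedSpace ℝ E]
  {M : Type*} [TopologicalSpace M] [ChartedSpace E M] [IsManifold 𝓘(ℝ, E) ∞ M]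

/-- A chart of `TM` covers whole fibres, so only the position is constrained. -/
lemma mem_tangent_target_iff (p : TM E M) (z : E × E) :
    z ∈ (extChartAt 𝓘(ℝ, E).tangent p).target ↔ z.1 ∈ (extChartAt 𝓘(ℝ, E) p.proj).target := by
  have h := TangentBundle.mem_chart_target_iff (I := 𝓘(ℝ, E)) z p
  have h1 : z ∈ (extChartAt 𝓘(ℝ, E).tangent p).target ↔ z ∈ (chartAt (ModelProd E E) p).target := by
    rw [extChartAt, OpenPartialHomeomorph.extend_target']
    simp
    exact h
  rw [h1, h]
  simp

lemma projDeriv_chartFrame {p : TM E M} {z : E × E}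
    (hz : z ∈ (extChartAt 𝓘(ℝ, E).tangent p).target) (Z : E × E) :
    projDeriv ((extChartAt 𝓘(ℝ, E).tangent p).symm z) (chartFrame 𝓘(ℝ, E).tangent p z Z) =
      chartFrame 𝓘(ℝ, E) p.proj z.1 Z.1 := by
  have h1 := mfderiv_comp z (I := 𝓘(ℝ, E × E)) (I' := 𝓘(ℝ, E).tangent) (I'' := 𝓘(ℝ, E))
    (g := fun w : TM E M => w.proj)
    ((contMDiff_proj (n := ∞) (TangentSpace 𝓘(ℝ, E) : M → Type _)).mdifferentiable (by simp) _)
    (mdifferentiableAt_extChartAt_symm hz)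
  have h2 := mfderiv_comp z (I := 𝓘(ℝ, E × E)) (I' := 𝓘(ℝ, E)) (I'' := 𝓘(ℝ, E))
    (g := (extChartAt 𝓘(ℝ, E) p.proj).symm) (f := (Prod.fst : E × E → E))
    (mdifferentiableAt_extChartAt_symm ((mem_tangent_target_iff p z).1 hz))
    (differentiableAt_fst.mdifferentiableAt)
  rw [mfderiv_eq_fderiv, fderiv_fst] at h2
  -- The composites differentiated in `h1` and `h2` are the same function by definition: in charts,
  -- `π` is `Prod.fst`.
  exact congrArg (fun L => L Z) (h1.symm.trans h2)

/-- On each fibre the inverse chart of `TM` is the inverse of the trivialization, which is the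
derivative of the inverse chart of `M`. -/
lemma tangent_symm_snd {p : TM E M} {z : E × E}
    (hz : z ∈ (extChartAt 𝓘(ℝ, E).tangent p).target) :
    ((extChartAt 𝓘(ℝ, E).tangent p).symm z).snd = chartFrame 𝓘(ℝ, E) p.proj z.1 z.2 := by
  have hz1 := (mem_tangent_target_iff p z).1 hz
  have hb : (extChartAt 𝓘(ℝ, E) p.proj).symm z.1 ∈ (chartAt E p.proj).source := by
    rw [← extChartAt_source 𝓘(ℝ, E)]
    exact (extChartAt 𝓘(ℝ, E) p.proj).map_target hz1
  have h := TangentBundle.symmL_trivializationAt (I := 𝓘(ℝ, E)) hb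
  rw [(extChartAt 𝓘(ℝ, E) p.proj).right_inv hz1, ModelWithCorners.range_eq_univ,
    mfderivWithin_univ] at h
  refine Eq.trans ?_ (congrArg (fun L => L z.2) h)
  have h3 := (trivializationAt E (TangentSpace 𝓘(ℝ, E)) p.proj).mk_symm hb z.2
  rw [Bundle.Trivialization.symmL_apply _ hb]
  exact eq_of_heq ((TotalSpace.mk.inj h3).2).symm

/-! ### The metric, `θ`, `dθ` and `θ̇` in coordinates. -/

/-- The metric in the preferred chart at `p`. -/
def chartMetric (g : PseudoRiemannianMetric E M) (p : M) (x : E) : E →L[ℝ] E →L[ℝ] ℝ :=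
  ContinuousLinearMap.bilinearComp (E := E) (F := E) (G := ℝ)
    (show E →L[ℝ] E →L[ℝ] ℝ from g.val ((extChartAt 𝓘(ℝ, E) p).symm x))
    (chartFrame 𝓘(ℝ, E) p x) (chartFrame 𝓘(ℝ, E) p x)

lemma chartMetric_apply (g : PseudoRiemannianMetric E M) (p : M) (x u w : E) :
    chartMetric g p x u w = g.val ((extChartAt 𝓘(ℝ, E) p).symm x)
      (chartFrame 𝓘(ℝ, E) p x u) (chartFrame 𝓘(ℝ, E) p x w) := rfl

lemma chartMetric_symm (g : PseudoRiemannianMetric E M) (p : M) (x u w : E) :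
    chartMetric g p x u w = chartMetric g p x w u :=
  (chartMetric_apply g p x u w).trans <|
    (g.symm _ (chartFrame 𝓘(ℝ, E) p x u) (chartFrame 𝓘(ℝ, E) p x w)).trans
      (chartMetric_apply g p x w u).symm

lemma contDiffOn_chartMetric [FiniteDimensional ℝ E] (g : PseudoRiemannianMetric E M) (p : M) :
    ContDiffOn ℝ ∞ (chartMetric g p) (extChartAt 𝓘(ℝ, E) p).target := by
  rw [contDiffOn_clm_apply]
  intro u
  rw [contDiffOn_clm_apply]
  intro w
  exact contDiffOn_of_contMDiffOn_trivial (J := 𝓘(ℝ, E)) (ContMDiffOn.clm_bundle_apply₂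
    (E₃ := Bundle.Trivial M ℝ)
    (g.contMDiff.comp_contMDiffOn (contMDiffOn_extChartAt_symm p)) (contMDiffOn_chartFrame p u)
      (contMDiffOn_chartFrame p w))

lemma contDiffAt_chartMetric [FiniteDimensional ℝ E] (g : PseudoRiemannianMetric E M) {p : M}
    {x : E} (hx : x ∈ (extChartAt 𝓘(ℝ, E) p).target) : ContDiffAt ℝ ∞ (chartMetric g p) x :=
  (contDiffOn_chartMetric g p).contDiffAt ((isOpen_extChartAt_target p).mem_nhds hx)

lemma isInvertible_chartMetric [FiniteDimensional ℝ E] (g : PseudoRiemannianMetric E M) {p : M}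
    {x : E} (hx : x ∈ (extChartAt 𝓘(ℝ, E) p).target) : (chartMetric g p x).IsInvertible := by
  refine isInvertible_of_nondegenerate fun u hu => ?_
  refine chartFrame_injective hx ?_
  rw [map_zero]
  refine g.nondegenerate _ _ fun w => ?_
  obtain ⟨w, rfl⟩ := chartFrame_surjective hx w
  exact hu w

lemma chartCovector_liouville (g : PseudoRiemannianMetric E M) {p : TM E M} {z : E × E}
    (hz : z ∈ (extChartAt 𝓘(ℝ, E).tangent p).target) :
    chartCovector (liouville g) p z = modelLiouville (chartMetric g p.proj) z := by
  refine ContinuousLinearMap.ext fun Z => ?_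
  change g.val _ ((extChartAt 𝓘(ℝ, E).tangent p).symm z).snd
    (projDeriv _ (chartFrame 𝓘(ℝ, E).tangent p z Z)) = _
  rw [projDeriv_chartFrame hz, tangent_symm_snd hz]
  rfl

lemma thetaDot_symm (g : PseudoRiemannianMetric E M) {p : TM E M} {z : E × E}
    (hz : z ∈ (extChartAt 𝓘(ℝ, E).tangent p).target) :
    thetaDot g ((extChartAt 𝓘(ℝ, E).tangent p).symm z) =
      modelThetaDot (chartMetric g p.proj) z := by
  change g.val _ ((extChartAt 𝓘(ℝ, E).tangent p).symm z).snd
    ((extChartAt 𝓘(ℝ, E).tangent p).symm z).snd = _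
  rw [tangent_symm_snd hz]
  rfl

lemma symplecticForm_chartFrame [FiniteDimensional ℝ E] (g : PseudoRiemannianMetric E M)
    {p : TM E M} {z : E × E} (hz : z ∈ (extChartAt 𝓘(ℝ, E).tangent p).target) (X Y : E × E) :
    symplecticForm g ((extChartAt 𝓘(ℝ, E).tangent p).symm z)
      (chartFrame 𝓘(ℝ, E).tangent p z X) (chartFrame 𝓘(ℝ, E).tangent p z Y) =
    fderiv ℝ (modelLiouville (chartMetric g p.proj)) z X Y -
      fderiv ℝ (modelLiouville (chartMetric g p.proj)) z Y X := by
  -- Agreement on a neighbourhood, not just at `z`, is needed to differentiate.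
  have hev : chartCovector (liouville g) p =ᶠ[nhds z] modelLiouville (chartMetric g p.proj) := by
    filter_upwards [(isOpen_extChartAt_target p).mem_nhds hz] with y hy
    exact chartCovector_liouville g hy
  have hG := (contDiffAt_chartMetric g ((mem_tangent_target_iff p z).1 hz)).differentiableAt
    (by simp)
  have hd : DifferentiableAt ℝ (chartCovector (liouville g) p) z :=
    (hasFDerivAt_modelLiouville hG).differentiableAt.congr_of_eventuallyEq hev
  have hz' := (extChartAt 𝓘(ℝ, E).tangent p).right_inv hz
  have h := extDerivOneForm_eq (β := liouville g) ((extChartAt 𝓘(ℝ, E).tangent p).map_target hz)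
    (by rwa [hz']) (chartFrame 𝓘(ℝ, E).tangent p z X) (chartFrame 𝓘(ℝ, E).tangent p z Y)
  rw [hz', chartCoframe_chartFrame hz, chartCoframe_chartFrame hz, hev.fderiv_eq] at h
  exact h

lemma differential_chartFrame {f : TM E M → ℝ} {p : TM E M} {φ : E × E → ℝ}
    {z : E × E} (hz : z ∈ (extChartAt 𝓘(ℝ, E).tangent p).target)
    (hf : ∀ y ∈ (extChartAt 𝓘(ℝ, E).tangent p).target,
      f ((extChartAt 𝓘(ℝ, E).tangent p).symm y) = φ y)
    (hφ : DifferentiableAt ℝ φ z) (X : E × E) :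
    differential f ((extChartAt 𝓘(ℝ, E).tangent p).symm z)
      (chartFrame 𝓘(ℝ, E).tangent p z X) = fderiv ℝ φ z X := by
  have hev : f ∘ (extChartAt 𝓘(ℝ, E).tangent p).symm =ᶠ[nhds z] φ := by
    filter_upwards [(isOpen_extChartAt_target p).mem_nhds hz] with y hy
    exact hf y hy
  have hz' := (extChartAt 𝓘(ℝ, E).tangent p).right_inv hz
  have h := mfderiv_eq_fderiv_chart (f := f) ((extChartAt 𝓘(ℝ, E).tangent p).map_target hz)
    (by rw [hz']; exact hφ.congr_of_eventuallyEq hev) (chartFrame 𝓘(ℝ, E).tangent p z X)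
  rw [hz', chartCoframe_chartFrame hz, hev.fderiv_eq] at h
  exact h

/-- Every point of `TM` is the image of a point of the model by the inverse of a chart. -/
lemma exists_chartFrame_eq (v : TM E M) : ∃ (p : TM E M) (z : E × E),
    z ∈ (extChartAt 𝓘(ℝ, E).tangent p).target ∧ (extChartAt 𝓘(ℝ, E).tangent p).symm z = v :=
  ⟨v, _, mem_extChartAt_target v, extChartAt_to_inv v⟩

lemma differentiableAt_modelThetaDot_chartMetric [FiniteDimensional ℝ E]
    (g : PseudoRiemannianMetric E M) {p : TM E M} {z : E × E}
    (hz : z ∈ (extChartAt 𝓘(ℝ, E).tangent p).target) :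
    DifferentiableAt ℝ (modelThetaDot (chartMetric g p.proj)) z :=
  (hasFDerivAt_modelThetaDot ((contDiffAt_chartMetric g
    ((mem_tangent_target_iff p z).1 hz)).differentiableAt (by simp))).differentiableAt

lemma differential_kineticEnergy_chartFrame [FiniteDimensional ℝ E]
    (g : PseudoRiemannianMetric E M) {p : TM E M} {z : E × E}
    (hz : z ∈ (extChartAt 𝓘(ℝ, E).tangent p).target) (X : E × E) :
    differential (kineticEnergy g) ((extChartAt 𝓘(ℝ, E).tangent p).symm z)
      (chartFrame 𝓘(ℝ, E).tangent p z X) =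
        (1 / 2 : ℝ) * fderiv ℝ (modelThetaDot (chartMetric g p.proj)) z X := by
  have hd := differentiableAt_modelThetaDot_chartMetric g hz
  rw [differential_chartFrame (φ := fun y => (1 / 2 : ℝ) * modelThetaDot (chartMetric g p.proj) y)
    hz (fun y hy => by rw [kineticEnergy, thetaDot_symm g hy]) (hd.const_mul _),
    fderiv_const_mul hd]
  rfl

lemma differential_kineticEnergy [FiniteDimensional ℝ E] (g : PseudoRiemannianMetric E M)
    (v : TM E M) (X : TangentSpace 𝓘(ℝ, E).tangent v) :
    differential (kineticEnergy g) v X = (1 / 2 : ℝ) * differential (thetaDot g) v X := by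
  obtain ⟨p, z, hz, rfl⟩ := exists_chartFrame_eq v
  obtain ⟨X, rfl⟩ := chartFrame_surjective hz X
  rw [differential_kineticEnergy_chartFrame g hz, differential_chartFrame hz
    (fun y hy => thetaDot_symm g hy) (differentiableAt_modelThetaDot_chartMetric g hz)]

lemma symplecticForm_self (g : PseudoRiemannianMetric E M) (v : TM E M)
    (X : TangentSpace 𝓘(ℝ, E).tangent v) : symplecticForm g v X X = 0 :=
  ContinuousAlternatingMap.map_eq_zero_of_eq _ _ (i := 0) (j := 1) rfl (by decide)

/-! ### The evolution field: pointwise solution and smoothness. -/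

/-- The conditions on the value `X` at `v` of the evolution field of `S`. -/
def IsNewtonVector (S : MechanicalSystem E M) (v : TM E M)
    (D : TangentSpace 𝓘(ℝ, E).tangent v) : Prop :=
  projDeriv v D = v.snd ∧ ∀ X : TangentSpace 𝓘(ℝ, E).tangent v,
    symplecticForm S.metric v D X + differential (kineticEnergy S.metric) v X
      + S.workForm v X = 0

lemma isEvolutionField_iff (S : MechanicalSystem E M) (D : FieldOnTM E M) :
    IsEvolutionField S D ↔ ∀ v, IsNewtonVector S v (D v) :=
  forall_and.symm

lemma chartCovector_workForm_vertical (S : MechanicalSystem E M) {p : TM E M} {z : E × E}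
    (hz : z ∈ (extChartAt 𝓘(ℝ, E).tangent p).target) (b : E) :
    chartCovector (fun q => S.workForm q) p z (0, b) = 0 :=
  S.horizontal _ _ ((projDeriv_chartFrame hz (0, b)).trans (map_zero _))

/-- The second order equation of the system `S` in the preferred chart at `p`. -/
def chartSpray (S : MechanicalSystem E M) (p : TM E M) : E × E → E × E :=
  modelSpray (chartMetric S.metric p.proj) (chartCovector (fun q => S.workForm q) p)

/-- The formula on the right holds for all `z` in one chart, so this equivalence yields existence,
uniqueness and smoothness at once. -/
lemma isNewtonVector_chartFrame_iff [FiniteDimensional ℝ E] (S : MechanicalSystem E M)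
    {p : TM E M} {z : E × E} (hz : z ∈ (extChartAt 𝓘(ℝ, E).tangent p).target) (Z : E × E) :
    IsNewtonVector S ((extChartAt 𝓘(ℝ, E).tangent p).symm z)
      (chartFrame 𝓘(ℝ, E).tangent p z Z) ↔ Z = chartSpray S p z := by
  have hz1 := (mem_tangent_target_iff p z).1 hz
  have hG := (contDiffAt_chartMetric S.metric hz1).differentiableAt (by simp)
  have h1 : projDeriv ((extChartAt 𝓘(ℝ, E).tangent p).symm z)
      (chartFrame 𝓘(ℝ, E).tangent p z Z) =
        ((extChartAt 𝓘(ℝ, E).tangent p).symm z).snd ↔ Z.1 = z.2 := by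
    rw [projDeriv_chartFrame hz, tangent_symm_snd hz]
    exact (chartFrame_injective hz1).eq_iff
  have h2 : ∀ W : E × E, S.workForm ((extChartAt 𝓘(ℝ, E).tangent p).symm z)
      (chartFrame 𝓘(ℝ, E).tangent p z W) =
        chartCovector (fun q => S.workForm q) p z W := fun W => rfl
  rw [chartSpray, eq_modelSpray_iff (isInvertible_chartMetric S.metric hz1), IsNewtonVector, h1]
  refine and_congr_right fun ha => ?_
  obtain ⟨a, b⟩ := Z
  obtain rfl : a = z.2 := ha
  rw [← model_newton_iff hG (chartMetric_symm S.metric p.proj z.1)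
    (chartCovector_workForm_vertical S hz) b, (chartFrame_surjective hz).forall]
  refine forall_congr' fun W => ?_
  rw [symplecticForm_chartFrame S.metric hz, differential_kineticEnergy_chartFrame S.metric hz, h2]

lemma existsUnique_isNewtonVector [FiniteDimensional ℝ E] (S : MechanicalSystem E M)
    (v : TM E M) : ∃! D, IsNewtonVector S v D := by
  obtain ⟨p, z, hz, rfl⟩ := exists_chartFrame_eq v
  refine ⟨_, (isNewtonVector_chartFrame_iff S hz _).2 rfl, fun D hD => ?_⟩
  obtain ⟨Z, rfl⟩ := chartFrame_surjective hz D
  rw [(isNewtonVector_chartFrame_iff S hz Z).1 hD]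

lemma contDiffAt_chartSpray [FiniteDimensional ℝ E] (S : MechanicalSystem E M)
    {p : TM E M} {z : E × E} (hz : z ∈ (extChartAt 𝓘(ℝ, E).tangent p).target) :
    ContDiffAt ℝ ∞ (chartSpray S p) z := by
  have hz1 := (mem_tangent_target_iff p z).1 hz
  exact contDiffAt_modelSpray (contDiffAt_chartMetric S.metric hz1)
    ((contDiffOn_chartCovector S.workForm p).contDiffAt
      ((isOpen_extChartAt_target p).mem_nhds hz)) (isInvertible_chartMetric S.metric hz1)

theorem existsUnique_isEvolutionField [FiniteDimensional ℝ E] (S : MechanicalSystem E M) :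
    ∃! D : FieldOnTM E M, IsEvolutionField S D := by
  choose D hD huniq using existsUnique_isNewtonVector S
  have hsmooth : ContMDiff 𝓘(ℝ, E).tangent 𝓘(ℝ, E).tangent.tangent ∞
      (fun q => TotalSpace.mk' (E × E)
        (E := (TangentSpace 𝓘(ℝ, E).tangent : TM E M → Type _)) q (D q)) := fun p => by
    refine contMDiffAt_section_of_chartCoframe
      (contDiffAt_chartSpray S (mem_extChartAt_target p)) fun q hq => ?_
    obtain ⟨z, hz, rfl⟩ : ∃ z ∈ (extChartAt 𝓘(ℝ, E).tangent p).target,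
        (extChartAt 𝓘(ℝ, E).tangent p).symm z = q :=
      ⟨_, (extChartAt 𝓘(ℝ, E).tangent p).map_source hq,
        (extChartAt 𝓘(ℝ, E).tangent p).left_inv hq⟩
    -- Uniqueness identifies the chosen vector at each `q` of the chart domain with the smooth chart
    -- solution, so no gluing is needed.
    rw [← huniq _ _ ((isNewtonVector_chartFrame_iff S hz _).2 rfl), chartCoframe_chartFrame hz,
      (extChartAt 𝓘(ℝ, E).tangent p).right_inv hz]
  refine ⟨⟨D, hsmooth⟩, (isEvolutionField_iff S _).2 hD, fun D' hD' => ?_⟩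
  exact ContMDiffSection.ext fun v => huniq v _ ((isEvolutionField_iff S D').1 hD' v)

/-! ### The relativistic condition and the contact system. -/

/-- Along the evolution field, the derivative of `θ̇` is `-2` times the work. -/
lemma differential_thetaDot_of_isEvolutionField [FiniteDimensional ℝ E]
    {S : MechanicalSystem E M} {D : FieldOnTM E M} (hD : IsEvolutionField S D) (v : TM E M) :
    differential (thetaDot S.metric) v (D v) = -2 * S.workForm v (D v) := by
  have h := hD.2 v (D v)
  rw [symplecticForm_self, differential_kineticEnergy] at h
  linarith

/-- `X - Y` is tangent to the fibre. -/
lemma horizontal_apply_eq {α : FormOnTM E M} (hα : IsHorizontal α) {v : TM E M}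
    {X Y : TangentSpace 𝓘(ℝ, E).tangent v} (h : projDeriv v X = projDeriv v Y) :
    α v X = α v Y := by
  rw [← sub_eq_zero, ← map_sub]
  exact hα v _ (by rw [map_sub, h, sub_self])

theorem isRelativistic_iff_mem_contactSystem [FiniteDimensional ℝ E]
    (S : MechanicalSystem E M) : IsRelativistic S ↔ S.workForm ∈ contactSystem E M := by
  constructor
  · rintro ⟨D, hD, hrel⟩ D' hD' v
    have h := differential_thetaDot_of_isEvolutionField hD v
    rw [hrel v] at h
    -- Both fields project to `v`, so `α` takes the same value on `D'` and on `D`.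
    rw [horizontal_apply_eq S.horizontal ((hD' v).trans (hD.1 v).symm)]
    linarith
  · intro h
    -- `IsRelativistic` asks for an evolution field, so existence enters here.
    obtain ⟨D, hD, -⟩ := existsUnique_isEvolutionField S
    exact ⟨D, hD, fun v => by
      rw [differential_thetaDot_of_isEvolutionField hD, h D hD.1 v, mul_zero]⟩

end TangentBundleCharts

end Mechanics

end

theorem mainTheorem7 {E : Type*} [NormedAddCommGroup E] [NormedSpace ℝ E] [FiniteDimensional ℝ E]
    {M : Type*} [TopologicalSpace M] [ChartedSpace E M] [IsManifold 𝓘(ℝ, E) ∞ M]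
    (S : Mechanics.MechanicalSystem E M) :
    (∃! D : Mechanics.FieldOnTM E M, Mechanics.IsEvolutionField S D) ∧
    (Mechanics.IsRelativistic S ↔ S.workForm ∈ Mechanics.contactSystem E M) ∧
    (∀ S' : Mechanics.MechanicalSystem E M, S'.workForm = S.workForm →
      (Mechanics.IsRelativistic S' ↔ Mechanics.IsRelativistic S)) := by
  refine ⟨Mechanics.existsUnique_isEvolutionField S,
    Mechanics.isRelativistic_iff_mem_contactSystem S, fun S' h => ?_⟩
  rw [Mechanics.isRelativistic_iff_mem_contactSystem,
    Mechanics.isRelativistic_iff_mem_contactSystem, h]
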